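/- For $z\in\mathbb C$ put $\|z\|=\max\{|\Re z|,|\Im z|\}$ and let $[z]=\lfloor \Re z+\tfrac12\rfloor+i\lfloor \Im z+\tfrac12\rfloor\in\mathbb Z[i]$. Let $\mathfrak F=\{z\in\mathbb C:-\tfrac12\le \Re z,\ \Im z<\tfrac12\}=\{z\in\mathbb C:[z]=0\}$. For $z\in\mathfrak F$ put $z_1=z$ and, as long as $z_n\ne0$, $a_n=[1/z_n]$ and $z_{n+1}=1/z_n-a_n$; the sequence $(a_n)_{n\ge1}$ of Gaussian integers is the Hurwitz continued fraction of $z$, and we write $z=[0;a_1,a_2,\ldots]$ if it is infinite. **Lemma.** Let $f,g:\{1,2,3,\ldots\}\to\mathbb R_{>0}$ be functions such that for some fixed $c'$ with $0<c'<1$ we have $\sqrt8\le f(n)<c'g(n)$ for all $n\ge1$, such that for every $n\ge1$ the interval $[f(n),g(n)]$ contains an integer, such that $f(n)\to\infty$ as $n\to\infty$, and such that $$\limsup_{n\to\infty}\frac{\log\log g(n)}{\log n}<1 .$$ Then the set $$E_{f,g}=\{z=[0;a_1,a_2,a_3,\ldots]\in\mathfrak F:\ f(n)\le\|a_n\|\le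 g(n)\ \text{for all } n\ge1\}$$ has Hausdorff dimension $1$. -/

import Mathlib

open Filter Topology

noncomputable section

/-- The Gaussian integer `[z] = ⌊Re z + 1/2⌋ + i ⌊Im z + 1/2⌋` nearest to `z`. -/
def nearestGaussian (z : ℂ) : GaussianInt :=
  ⟨⌊z.re + 1 / 2⌋, ⌊z.im + 1 / 2⌋⟩

/-- The half-open unit square `𝔉`, that is, the set of `z` with `[z] = 0`. -/
def hurwitzSquare : Set ℂ :=
  {z | (-(1 / 2) ≤ z.re ∧ z.re < 1 / 2) ∧ (-(1 / 2) ≤ z.im ∧ z.im < 1 / 2)}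

/-- The Hurwitz map `T z = 1 / z - [1 / z]`. It is meant for `z ≠ 0`; the value at `0` is
irrelevant, see `HasInfiniteHCF`. -/
def hurwitzMap (z : ℂ) : ℂ :=
  1 / z - (nearestGaussian (1 / z) : ℂ)

/-- `hurwitzRemainder z n` is `T ^ n (z - [z])`. -/
def hurwitzRemainder (z : ℂ) : ℕ → ℂ
  | 0 => z - (nearestGaussian z : ℂ)
  | n + 1 => hurwitzMap (hurwitzRemainder z n)

/-- The elements of the Hurwitz continued fraction `[a₀; a₁, a₂, …]` of `z`: `a₀ = [z]` and
`aₙ₊₁ = [1 / T ^ n (z - [z])]`, as long as `T ^ n (z - [z]) ≠ 0`. -/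
def hurwitzElement (z : ℂ) : ℕ → GaussianInt
  | 0 => nearestGaussian z
  | n + 1 => nearestGaussian (1 / hurwitzRemainder z n)

/-- The Hurwitz algorithm never stops on `z`, so that all elements `aₙ` of `z` are defined. -/
def HasInfiniteHCF (z : ℂ) : Prop :=
  ∀ n, hurwitzRemainder z n ≠ 0

/-- `‖z‖ = max (|Re z|, |Im z|)`. -/
def maxNorm (z : ℂ) : ℝ :=
  max |z.re| |z.im|

/-- The set `E_{f,g}` of all `z = [0; a₁, a₂, …]` in `𝔉` with
`f n ≤ ‖aₙ‖ ≤ g n` for all `n ≥ 1`. -/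
def hurwitzBand (f g : ℕ → ℝ) : Set ℂ :=
  {z | z ∈ hurwitzSquare ∧ HasInfiniteHCF z ∧
    ∀ n : ℕ, 1 ≤ n → f n ≤ maxNorm (hurwitzElement z n) ∧ maxNorm (hurwitzElement z n) ≤ g n}

end

/-!
All digits `aₙ` of points of the band have modulus at least `3`. Fixing the first `n` digits
`a₁, …, aₙ` confines `z` to a set of diameter at most `(3 / 2) ∏ (3 / 4 |aₖ|)⁻²`, and the sum
`∑ |a|^(-2 s)` over the Gaussian integers converges for `s > 1`. Since the admissible digits escape
to infinity, their contributions to this sum eventually stay below `1`, so the `s`-dimensional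
Hausdorff measure of the band is finite.

For the lower bound, choose at least a constant times `f k ^ 2` digits of modulus `O(f k)` in the
`k`-th band and use them to encode the mixed radix expansions of the points of `[0, 1)`. Codes
differing first at position `n` are at least `∏_{k ≤ n} c (f k)⁻²` apart, up to a factor `9`, while
the coded numbers are at most `∏_{k < n} C (f k)⁻²` apart. As `log f n = o(∑_{k < n} log f k)`, the
extra factor is absorbed on raising the former product to any power `r < 1`; decoding is then
`r`-Hölder onto `[0, 1)`.
-/

section Square

variable {z : ℂ}

lemma maxNorm_le_norm (z : ℂ) : maxNorm z ≤ ‖z‖ :=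
  max_le (Complex.abs_re_le_norm z) (Complex.abs_im_le_norm z)

lemma norm_le_of_mem_hurwitzSquare (hz : z ∈ hurwitzSquare) : ‖z‖ ≤ 3 / 4 := by
  obtain ⟨⟨hre, hre'⟩, him, him'⟩ := hz
  refine (abs_le_of_sq_le_sq' ?_ (by norm_num)).2
  rw [Complex.sq_norm, Complex.normSq_apply]
  nlinarith

lemma mem_hurwitzSquare_of_norm_lt (hz : ‖z‖ < 1 / 2) : z ∈ hurwitzSquare := by
  have hre := abs_lt.1 ((Complex.abs_re_le_norm z).trans_lt hz)
  have him := abs_lt.1 ((Complex.abs_im_le_norm z).trans_lt hz)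
  exact ⟨⟨hre.1.le, hre.2⟩, him.1.le, him.2⟩

lemma sub_nearestGaussian_mem_hurwitzSquare (z : ℂ) :
    z - (nearestGaussian z : ℂ) ∈ hurwitzSquare := by
  have hre := Int.floor_le (z.re + 1 / 2)
  have hre' := Int.lt_floor_add_one (z.re + 1 / 2)
  have him := Int.floor_le (z.im + 1 / 2)
  have him' := Int.lt_floor_add_one (z.im + 1 / 2)
  simp only [hurwitzSquare, nearestGaussian, Set.mem_ofPred_eq, Complex.sub_re, Complex.sub_im,
    GaussianInt.re_toComplex, GaussianInt.im_toComplex]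
  refine ⟨⟨?_, ?_⟩, ?_, ?_⟩ <;> linarith

lemma nearestGaussian_add (a : GaussianInt) (hz : z ∈ hurwitzSquare) :
    nearestGaussian (a + z) = a := by
  obtain ⟨⟨hre, hre'⟩, him, him'⟩ := hz
  apply Zsqrtd.ext
  · rw [nearestGaussian, Int.floor_eq_iff, Complex.add_re, ← GaussianInt.intCast_re]
    constructor <;> linarith
  · rw [nearestGaussian, Int.floor_eq_iff, Complex.add_im, ← GaussianInt.intCast_im]
    constructor <;> linarith

lemma hurwitzRemainder_mem_hurwitzSquare (z : ℂ) : ∀ n, hurwitzRemainder z n ∈ hurwitzSquare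
  | 0 => sub_nearestGaussian_mem_hurwitzSquare z
  | _ + 1 => sub_nearestGaussian_mem_hurwitzSquare _

lemma hurwitzRemainder_zero (hz : z ∈ hurwitzSquare) : hurwitzRemainder z 0 = z := by
  have h : nearestGaussian z = 0 := by simpa using nearestGaussian_add 0 hz
  rw [hurwitzRemainder, h, GaussianInt.toComplex_zero, sub_zero]

end Square

section GaussianIntegers

/-- A Gaussian integer as a vector of `ℤ²`, whose supremum norm is `maxNorm`. -/
@[simps]
def gaussianVec : GaussianInt ≃ (Fin 2 → ℤ) where
  toFun a := ![a.re, a.im]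
  invFun v := ⟨v 0, v 1⟩
  left_inv _ := rfl
  right_inv v := by ext i; fin_cases i <;> rfl

lemma norm_gaussianVec (a : GaussianInt) : ‖gaussianVec a‖ = maxNorm a := by
  simp [EisensteinSeries.norm_eq_max_natAbs, maxNorm, ← GaussianInt.intCast_re,
    ← GaussianInt.intCast_im, Nat.cast_natAbs]

lemma three_le_maxNorm {a : GaussianInt} (ha : 2 < maxNorm a) : 3 ≤ maxNorm a := by
  rw [← norm_gaussianVec, EisensteinSeries.norm_eq_max_natAbs] at ha ⊢
  exact_mod_cast Nat.succ_le_of_lt (by exact_mod_cast ha)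

lemma one_le_norm_of_ne_zero {a : GaussianInt} (ha : a ≠ 0) : 1 ≤ ‖(a : ℂ)‖ := by
  have h : (1 : ℝ) ≤ a.norm := by exact_mod_cast GaussianInt.norm_pos.2 ha
  rw [GaussianInt.intCast_real_norm, Complex.normSq_eq_norm_sq] at h
  exact (one_le_sq_iff₀ (norm_nonneg _)).1 h

lemma finite_setOf_maxNorm_le (r : ℝ) : {a : GaussianInt | maxNorm a ≤ r}.Finite := by
  have h : (Metric.closedBall (0 : Fin 2 → ℤ) r).Finite :=
    (isCompact_closedBall 0 r).finite_of_discrete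
  refine (h.preimage gaussianVec.injective.injOn).subset fun a ha => ?_
  simpa [norm_gaussianVec] using ha

lemma summable_norm_rpow_neg {t : ℝ} (ht : 2 < t) :
    Summable fun a : GaussianInt => ‖(a : ℂ)‖ ^ (-t) := by
  refine .of_nonneg_of_le (fun a => by positivity) (fun a => ?_)
    ((EisensteinSeries.summable_one_div_norm_rpow ht).comp_injective gaussianVec.injective)
  rw [Function.comp_apply]
  rcases eq_or_ne a 0 with rfl | ha
  · simp [show gaussianVec 0 = 0 from by ext i; fin_cases i <;> rfl]
  · have hpos : 0 < ‖gaussianVec a‖ := norm_pos_iff.2 fun h => ha (gaussianVec.injective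
      (h.trans (by ext i; fin_cases i <;> rfl)))
    exact Real.rpow_le_rpow_of_nonpos hpos (norm_gaussianVec a ▸ maxNorm_le_norm a)
      (by linarith)

end GaussianIntegers

/-- `w k` is the value of the Hurwitz continued fraction `[0; aₖ, aₖ₊₁, …]`, for every `k`. The
elements are indexed from `0`, so that `a k` is `hurwitzElement (w 0) (k + 1)`. -/
structure IsHurwitzExpansion (a : ℕ → GaussianInt) (w : ℕ → ℂ) : Prop where
  mem_hurwitzSquare (k : ℕ) : w k ∈ hurwitzSquare
  mul_eq_one (k : ℕ) : w k * (a k + w (k + 1)) = 1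

lemma HasInfiniteHCF.isHurwitzExpansion {z : ℂ} (hz : HasInfiniteHCF z) :
    IsHurwitzExpansion (fun k => hurwitzElement z (k + 1)) (hurwitzRemainder z) where
  mem_hurwitzSquare := hurwitzRemainder_mem_hurwitzSquare z
  mul_eq_one k := by
    rw [hurwitzElement, hurwitzRemainder, hurwitzMap, add_sub_cancel, mul_one_div_cancel (hz k)]

namespace IsHurwitzExpansion

variable {a b : ℕ → GaussianInt} {w v : ℕ → ℂ} {n : ℕ}

lemma ne_zero (hw : IsHurwitzExpansion a w) (k : ℕ) : w k ≠ 0 :=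
  left_ne_zero_of_mul_eq_one (hw.mul_eq_one k)

lemma one_div_eq (hw : IsHurwitzExpansion a w) (k : ℕ) : 1 / w k = a k + w (k + 1) :=
  (eq_one_div_of_mul_eq_one_right (hw.mul_eq_one k)).symm

lemma hurwitzRemainder_eq (hw : IsHurwitzExpansion a w) (k : ℕ) :
    hurwitzRemainder (w 0) k = w k := by
  induction k with
  | zero => exact hurwitzRemainder_zero (hw.mem_hurwitzSquare 0)
  | succ k ih =>
    rw [hurwitzRemainder, ih, hurwitzMap, hw.one_div_eq,
      nearestGaussian_add _ (hw.mem_hurwitzSquare _), add_sub_cancel_left]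

lemma hurwitzElement_eq (hw : IsHurwitzExpansion a w) (k : ℕ) :
    hurwitzElement (w 0) (k + 1) = a k := by
  rw [hurwitzElement, hw.hurwitzRemainder_eq, hw.one_div_eq,
    nearestGaussian_add _ (hw.mem_hurwitzSquare _)]

lemma mem_hurwitzBand {f g : ℕ → ℝ} (hw : IsHurwitzExpansion a w)
    (ha : ∀ k, f (k + 1) ≤ maxNorm (a k) ∧ maxNorm (a k) ≤ g (k + 1)) :
    w 0 ∈ hurwitzBand f g := by
  refine ⟨hw.mem_hurwitzSquare 0, fun k => hw.hurwitzRemainder_eq k ▸ hw.ne_zero k,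
    fun n hn => ?_⟩
  obtain ⟨k, rfl⟩ := Nat.exists_eq_add_of_le' hn
  exact hw.hurwitzElement_eq k ▸ ha k

lemma norm_eq_inv (hw : IsHurwitzExpansion a w) (k : ℕ) : ‖w k‖ = ‖a k + w (k + 1)‖⁻¹ := by
  rw [← hw.one_div_eq, norm_div, norm_one, one_div, inv_inv]

lemma norm_le_inv (hw : IsHurwitzExpansion a w) {k : ℕ} (ha : 3 ≤ ‖(a k : ℂ)‖) :
    ‖w k‖ ≤ (3 / 4 * ‖(a k : ℂ)‖)⁻¹ := by
  have htail := norm_le_of_mem_hurwitzSquare (hw.mem_hurwitzSquare (k + 1))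
  have htri := norm_sub_le_norm_add (a k : ℂ) (w (k + 1))
  rw [hw.norm_eq_inv]
  exact inv_anti₀ (by linarith) (by linarith)

lemma inv_le_norm (hw : IsHurwitzExpansion a w) {k : ℕ} (ha : 3 ≤ ‖(a k : ℂ)‖) :
    (5 / 4 * ‖(a k : ℂ)‖)⁻¹ ≤ ‖w k‖ := by
  have htail := norm_le_of_mem_hurwitzSquare (hw.mem_hurwitzSquare (k + 1))
  have htri := norm_add_le (a k : ℂ) (w (k + 1))
  rw [hw.norm_eq_inv]
  exact inv_anti₀ (inv_pos.1 (hw.norm_eq_inv k ▸ norm_pos_iff.2 (hw.ne_zero k))) (by linarith)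

lemma norm_sub_eq (hw : IsHurwitzExpansion a w) (hv : IsHurwitzExpansion b v) (k : ℕ) :
    ‖w k - v k‖ = ‖(a k + w (k + 1)) - (b k + v (k + 1))‖ * (‖w k‖ * ‖v k‖) := by
  have h : w k - v k = -((a k + w (k + 1)) - (b k + v (k + 1))) * (w k * v k) := by
    linear_combination v k * hw.mul_eq_one k - w k * hv.mul_eq_one k
  rw [h, norm_mul, norm_neg, norm_mul]

lemma norm_sub_eq_mul_prod (hw : IsHurwitzExpansion a w) (hv : IsHurwitzExpansion b v)
    (hab : ∀ k < n, a k = b k) :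
    ‖w 0 - v 0‖ = ‖w n - v n‖ * ∏ k ∈ Finset.range n, ‖w k‖ * ‖v k‖ := by
  induction n with
  | zero => simp
  | succ n ih =>
    rw [ih fun k hk => hab k (hk.trans n.lt_succ_self), hw.norm_sub_eq hv n,
      hab n n.lt_succ_self, add_sub_add_left_eq_sub, Finset.prod_range_succ]
    ring

lemma norm_sub_le (hw : IsHurwitzExpansion a w) (hv : IsHurwitzExpansion b v)
    (hab : ∀ k < n, a k = b k) (ha : ∀ k < n, 3 ≤ ‖(a k : ℂ)‖) :
    ‖w 0 - v 0‖ ≤ 3 / 2 * ∏ k ∈ Finset.range n, ((3 / 4 * ‖(a k : ℂ)‖)⁻¹) ^ 2 := by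
  have hwv : ‖w n - v n‖ ≤ 3 / 2 := by
    linarith [_root_.norm_sub_le (w n) (v n),
      norm_le_of_mem_hurwitzSquare (hw.mem_hurwitzSquare n),
      norm_le_of_mem_hurwitzSquare (hv.mem_hurwitzSquare n)]
  rw [hw.norm_sub_eq_mul_prod hv hab]
  gcongr with k hk
  have hk := Finset.mem_range.1 hk
  rw [sq]
  gcongr
  · exact hw.norm_le_inv (ha k hk)
  · exact (hv.norm_le_inv (hab k hk ▸ ha k hk)).trans_eq (by rw [hab k hk])

lemma prod_div_nine_le_norm_sub (hw : IsHurwitzExpansion a w) (hv : IsHurwitzExpansion b v)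
    (hab : ∀ k < n, a k = b k) (hn : a n ≠ b n)
    (ha : 3 ≤ ‖(a (n + 1) : ℂ)‖) (hb : 3 ≤ ‖(b (n + 1) : ℂ)‖) :
    (∏ k ∈ Finset.range (n + 1), ‖w k‖ * ‖v k‖) / 9 ≤ ‖w 0 - v 0‖ := by
  have hsmall {x : ℂ} {c : ℝ} (hc : 3 ≤ c) (hx : ‖x‖ ≤ (3 / 4 * c)⁻¹) : ‖x‖ ≤ 4 / 9 :=
    hx.trans (inv_le_of_inv_le₀ (by norm_num) (by linarith))
  have hdigit : 1 ≤ ‖(a n : ℂ) - b n‖ := by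
    simpa using one_le_norm_of_ne_zero (sub_ne_zero.2 hn)
  have hgap : 1 / 9 ≤ ‖(a n + w (n + 1)) - (b n + v (n + 1))‖ := by
    rw [add_sub_add_comm]
    linarith [norm_sub_le_norm_add ((a n : ℂ) - b n) (w (n + 1) - v (n + 1)),
      _root_.norm_sub_le (w (n + 1)) (v (n + 1)), hsmall ha (hw.norm_le_inv ha),
      hsmall hb (hv.norm_le_inv hb)]
  rw [hw.norm_sub_eq_mul_prod hv hab, hw.norm_sub_eq hv, mul_assoc, mul_comm (‖w n‖ * ‖v n‖),
    ← Finset.prod_range_succ (fun k => ‖w k‖ * ‖v k‖), div_eq_inv_mul, ← one_div]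
  gcongr

lemma inv_prod_sq_le_norm_sub {R : ℕ → ℝ} (hw : IsHurwitzExpansion a w)
    (hv : IsHurwitzExpansion b v) (hab : ∀ k < n, a k = b k) (hn : a n ≠ b n)
    (ha : ∀ k, 3 ≤ ‖(a k : ℂ)‖) (hb : ∀ k, 3 ≤ ‖(b k : ℂ)‖)
    (haR : ∀ k, ‖(a k : ℂ)‖ ≤ R k) (hbR : ∀ k, ‖(b k : ℂ)‖ ≤ R k) :
    (9 * ∏ k ∈ Finset.range (n + 1), (5 / 4 * R k) ^ 2)⁻¹ ≤ ‖w 0 - v 0‖ := by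
  have hbound {c : ℕ → GaussianInt} {u : ℕ → ℂ} (hu : IsHurwitzExpansion c u)
      (hc : ∀ k, 3 ≤ ‖(c k : ℂ)‖) (hcR : ∀ k, ‖(c k : ℂ)‖ ≤ R k) (k : ℕ) :
      (5 / 4 * R k)⁻¹ ≤ ‖u k‖ :=
    (inv_anti₀ (by linarith [hc k]) (by linarith [hcR k])).trans (hu.inv_le_norm (hc k))
  have hR (k : ℕ) : 0 ≤ R k := (norm_nonneg _).trans (haR k)
  refine le_trans ?_ (hw.prod_div_nine_le_norm_sub hv hab hn (ha _) (hb _))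
  rw [mul_inv, ← Finset.prod_inv_distrib, mul_comm, ← div_eq_mul_inv]
  gcongr with k
  rw [← inv_pow, sq]
  have := hR k
  gcongr
  · exact hbound hw ha haR k
  · exact hbound hv hb hbR k

end IsHurwitzExpansion

section Existence

/-- The finite continued fraction `[0; aₖ, …, aₖ₊ₙ₋₁]`, approximating the tail `[0; aₖ, aₖ₊₁, …]` as
`n → ∞`. -/
noncomputable def finiteCF (a : ℕ → GaussianInt) : ℕ → ℕ → ℂ
  | 0, _ => 0
  | n + 1, k => (a k + finiteCF a n (k + 1))⁻¹

variable {a : ℕ → GaussianInt}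

lemma norm_inv_add_le {x y : ℂ} (hx : 3 ≤ ‖x‖) (hy : ‖y‖ ≤ 2 / 5) : ‖(x + y)⁻¹‖ ≤ 2 / 5 := by
  rw [norm_inv, inv_le_comm₀ (by linarith [norm_sub_le_norm_add x y]) (by norm_num)]
  linarith [norm_sub_le_norm_add x y]

lemma norm_finiteCF_le (ha : ∀ k, 3 ≤ ‖(a k : ℂ)‖) :
    ∀ n k, ‖finiteCF a n k‖ ≤ 2 / 5
  | 0, _ => by rw [finiteCF, norm_zero]; norm_num
  | n + 1, k => norm_inv_add_le (ha k) (norm_finiteCF_le ha n (k + 1))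

lemma add_ne_zero_of_norm {x y : ℂ} (hx : 3 ≤ ‖x‖) (hy : ‖y‖ ≤ 2 / 5) : x + y ≠ 0 :=
  norm_pos_iff.1 (by linarith [norm_sub_le_norm_add x y])

lemma dist_finiteCF_succ_le (ha : ∀ k, 3 ≤ ‖(a k : ℂ)‖) (n k : ℕ) :
    dist (finiteCF a n k) (finiteCF a (n + 1) k) ≤ 2 / 5 * (4 / 25) ^ n := by
  induction n generalizing k with
  | zero => simpa [finiteCF] using norm_finiteCF_le ha 1 k
  | succ n ih =>
    have hden (m : ℕ) := add_ne_zero_of_norm (ha k) (norm_finiteCF_le ha m (k + 1))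
    calc dist (finiteCF a (n + 1) k) (finiteCF a (n + 2) k)
        = dist (finiteCF a n (k + 1)) (finiteCF a (n + 1) (k + 1)) *
            (‖finiteCF a (n + 1) k‖ * ‖finiteCF a (n + 2) k‖) := by
          rw [finiteCF, finiteCF, dist_inv_inv₀ (hden n) (hden (n + 1)), dist_add_left, norm_inv,
            norm_inv, div_eq_mul_inv, mul_inv]
      _ ≤ 2 / 5 * (4 / 25) ^ n * (2 / 5 * (2 / 5)) := by
          gcongr
          · exact ih (k + 1)
          · exact norm_finiteCF_le ha (n + 1) k
          · exact norm_finiteCF_le ha (n + 2) k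
      _ = 2 / 5 * (4 / 25) ^ (n + 1) := by ring

lemma exists_isHurwitzExpansion (ha : ∀ k, 3 ≤ ‖(a k : ℂ)‖) : ∃ w, IsHurwitzExpansion a w := by
  choose w hw using fun k => cauchySeq_tendsto_of_complete <|
    cauchySeq_of_le_geometric (4 / 25) (2 / 5) (by norm_num) (dist_finiteCF_succ_le ha · k)
  have hnorm (k : ℕ) : ‖w k‖ ≤ 2 / 5 :=
    le_of_tendsto (hw k).norm (.of_forall (norm_finiteCF_le ha · k))
  refine ⟨w, fun k => mem_hurwitzSquare_of_norm_lt ((hnorm k).trans_lt (by norm_num)), fun k => ?_⟩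
  refine tendsto_nhds_unique (((hw k).comp (tendsto_add_atTop_nat 1)).mul
    ((hw (k + 1)).const_add (a k : ℂ))) (tendsto_const_nhds.congr fun n => ?_)
  exact (inv_mul_cancel₀ (add_ne_zero_of_norm (ha k) (norm_finiteCF_le ha n (k + 1)))).symm

end Existence

section Cylinders

open MeasureTheory
open scoped NNReal ENNReal

variable {X α : Type*} [EMetricSpace X] {E : Set X} {digit : X → ℕ → α} {D : ℕ → Finset α}
  {p : α → ℝ≥0} {K ρ s : ℝ≥0}

/-- The points of `E` whose first `n` digits are `c 0, …, c (n - 1)`. For fixed `n` these sets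
cover `E`, which bounds its Hausdorff measure. -/
def digitCylinder (E : Set X) (digit : X → ℕ → α) {n : ℕ} (c : Fin n → α) : Set X :=
  {x ∈ E | ∀ k : Fin n, digit x k = c k}

lemma ediam_digitCylinder_le
    (hdist : ∀ x ∈ E, ∀ y ∈ E, ∀ n, (∀ k < n, digit x k = digit y k) →
      edist x y ≤ ↑(K * ∏ k ∈ Finset.range n, p (digit x k)))
    {n : ℕ} (c : Fin n → α) : Metric.ediam (digitCylinder E digit c) ≤ ↑(K * ∏ k, p (c k)) := by
  refine Metric.ediam_le fun x hx y hy => ?_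
  have h := hdist x hx.1 y hy.1 n fun k hk => (hx.2 ⟨k, hk⟩).trans (hy.2 ⟨k, hk⟩).symm
  simpa only [Finset.prod_range, hx.2] using h

lemma sum_ediam_digitCylinder_rpow_le
    (hdist : ∀ x ∈ E, ∀ y ∈ E, ∀ n, (∀ k < n, digit x k = digit y k) →
      edist x y ≤ ↑(K * ∏ k ∈ Finset.range n, p (digit x k))) (n : ℕ) :
    ∑ c ∈ Fintype.piFinset fun k : Fin n => D k, Metric.ediam (digitCylinder E digit c) ^ (s : ℝ) ≤
      ↑(K ^ (s : ℝ) * ∏ k ∈ Finset.range n, ∑ a ∈ D k, p a ^ (s : ℝ)) := by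
  calc ∑ c ∈ Fintype.piFinset fun k : Fin n => D k, Metric.ediam (digitCylinder E digit c) ^ (s : ℝ)
      ≤ ∑ c ∈ Fintype.piFinset fun k : Fin n => D k,
          ((K ^ (s : ℝ) * ∏ k, p (c k) ^ (s : ℝ) : ℝ≥0) : ℝ≥0∞) := by
        refine Finset.sum_le_sum fun c _ => ?_
        rw [NNReal.finsetProd_rpow, ← NNReal.mul_rpow, ENNReal.coe_rpow_of_nonneg _ s.coe_nonneg]
        exact ENNReal.rpow_le_rpow (ediam_digitCylinder_le hdist c) s.coe_nonneg
    _ = ↑(K ^ (s : ℝ) * ∏ k ∈ Finset.range n, ∑ a ∈ D k, p a ^ (s : ℝ)) := by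
        rw [← ENNReal.ofNNReal_finsetSum, ← Finset.mul_sum, Finset.prod_range,
          Finset.prod_univ_sum]

lemma dimH_le_of_digitCylinders (hρ : ρ < 1) (hmem : ∀ x ∈ E, ∀ k, digit x k ∈ D k)
    (hp : ∀ k, ∀ a ∈ D k, p a ≤ ρ)
    (hdist : ∀ x ∈ E, ∀ y ∈ E, ∀ n, (∀ k < n, digit x k = digit y k) →
      edist x y ≤ ↑(K * ∏ k ∈ Finset.range n, p (digit x k)))
    (hsum : ∀ᶠ k in atTop, ∑ a ∈ D k, p a ^ (s : ℝ) ≤ 1) : dimH E ≤ s := by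
  borelize X
  let cyl (n : ℕ) (c : Fintype.piFinset fun k : Fin n => D k) : Set X := digitCylinder E digit c.1
  have hmesh : Tendsto (fun n : ℕ => (↑(K * ρ ^ n) : ℝ≥0∞)) atTop (𝓝 0) := by
    simpa using ENNReal.tendsto_coe.2
      ((tendsto_pow_atTop_nhds_zero_of_lt_one zero_le hρ).const_mul K)
  have hdiam (n : ℕ) (c) : Metric.ediam (cyl n c) ≤ ↑(K * ρ ^ n) := by
    refine (ediam_digitCylinder_le hdist c.1).trans (ENNReal.coe_le_coe.2 ?_)
    gcongr
    simpa using Finset.prod_le_pow_card Finset.univ (fun k => p (c.1 k)) ρ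
      fun k _ => hp k _ (Fintype.mem_piFinset.1 c.2 k)
  have hcover (n : ℕ) : E ⊆ ⋃ c, cyl n c := fun x hx => Set.mem_iUnion.2
    ⟨⟨fun k => digit x k, Fintype.mem_piFinset.2 fun k => hmem x hx k⟩, hx, fun _ => rfl⟩
  obtain ⟨N, hN⟩ := eventually_atTop.1 hsum
  have hbound : ∀ᶠ n in atTop, ∑ c, Metric.ediam (cyl n c) ^ (s : ℝ) ≤
      ↑(K ^ (s : ℝ) * ∏ k ∈ Finset.range N, ∑ a ∈ D k, p a ^ (s : ℝ)) := by
    filter_upwards [eventually_ge_atTop N] with n hn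
    rw [Finset.sum_coe_sort (Fintype.piFinset fun k : Fin n => D k)
      fun c => Metric.ediam (digitCylinder E digit c) ^ (s : ℝ)]
    refine (sum_ediam_digitCylinder_rpow_le hdist n).trans (ENNReal.coe_le_coe.2 ?_)
    gcongr _ * ?_
    exact Finset.prod_le_prod_of_subset_of_le_one' (Finset.range_subset_range.2 hn)
      fun k _ hk => hN k (not_lt.1 (mt Finset.mem_range.2 hk))
  have hmeasure := (Measure.hausdorffMeasure_le_liminf_sum s E _ hmesh cyl (.of_forall hdiam)
    (.of_forall hcover)).trans (liminf_le_of_frequently_le' hbound.frequently)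
  exact dimH_le_of_hausdorffMeasure_ne_top (ne_top_of_le_ne_top ENNReal.coe_ne_top hmeasure)

end Cylinders

section MixedRadix

open scoped NNReal

lemma dimH_le_dimH_image_div {X Y : Type*} [EMetricSpace X] [EMetricSpace Y] {f : X → Y}
    {s : Set X} {C r : ℝ≥0} (hr : 0 < r)
    (hf : ∀ x ∈ s, ∀ y ∈ s, edist x y ≤ C * edist (f x) (f y) ^ (r : ℝ)) :
    dimH s ≤ dimH (f '' s) / r := by
  obtain rfl | ⟨x₀, -⟩ := s.eq_empty_or_nonempty
  · simp
  have : Nonempty X := ⟨x₀⟩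
  have hinj : Set.InjOn f s := fun x hx y hy hxy =>
    edist_le_zero.1 (by simpa [hxy, hr] using hf x hx y hy)
  have hholder : HolderOnWith C r (f.invFunOn s) (f '' s) := by
    rintro _ ⟨x, hx, rfl⟩ _ ⟨y, hy, rfl⟩
    simpa only [hinj.leftInvOn_invFunOn hx, hinj.leftInvOn_invFunOn hy] using hf x hx y hy
  simpa only [hinj.leftInvOn_invFunOn.image_image] using hholder.dimH_image_le hr

variable {N : ℕ → ℕ} [∀ k, NeZero (N k)] {n : ℕ} {x y : ℝ}

/-- The digits of `x ∈ [0, 1)` in the mixed radix expansion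
`x = d₀ / N₀ + d₁ / (N₀ N₁) + d₂ / (N₀ N₁ N₂) + ⋯`, where `0 ≤ dₙ < Nₙ`. -/
noncomputable def radixDigit (N : ℕ → ℕ) [∀ k, NeZero (N k)] (x : ℝ) (n : ℕ) : Fin (N n) :=
  Fin.ofNat (N n) ⌊(∏ k ∈ Finset.range (n + 1), N k : ℕ) * x⌋₊

lemma floor_prod_mul_succ (x : ℝ) (n : ℕ) :
    ⌊(∏ k ∈ Finset.range (n + 1), N k : ℕ) * x⌋₊ =
      N n * ⌊(∏ k ∈ Finset.range n, N k : ℕ) * x⌋₊ + radixDigit N x n := by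
  have hdiv : ⌊(∏ k ∈ Finset.range n, N k : ℕ) * x⌋₊ =
      ⌊(∏ k ∈ Finset.range (n + 1), N k : ℕ) * x⌋₊ / N n := by
    rw [← Nat.floor_div_natCast, Finset.prod_range_succ, Nat.cast_mul, mul_right_comm,
      mul_div_cancel_right₀ _ (Nat.cast_ne_zero.2 (NeZero.ne (N n)))]
  rw [hdiv, radixDigit, Fin.val_ofNat, Nat.div_add_mod]

lemma floor_prod_mul_eq (hx : x ∈ Set.Ico (0 : ℝ) 1) (hy : y ∈ Set.Ico (0 : ℝ) 1)
    (h : ∀ k < n, radixDigit N x k = radixDigit N y k) :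
    ⌊(∏ k ∈ Finset.range n, N k : ℕ) * x⌋₊ = ⌊(∏ k ∈ Finset.range n, N k : ℕ) * y⌋₊ := by
  induction n with
  | zero => simp [Nat.floor_eq_zero.2 hx.2, Nat.floor_eq_zero.2 hy.2]
  | succ n ih =>
    rw [floor_prod_mul_succ, floor_prod_mul_succ, h n n.lt_succ_self,
      ih fun k hk => h k (hk.trans n.lt_succ_self)]

lemma prod_mul_abs_sub_le_one (hx : x ∈ Set.Ico (0 : ℝ) 1) (hy : y ∈ Set.Ico (0 : ℝ) 1)
    (h : ∀ k < n, radixDigit N x k = radixDigit N y k) :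
    (∏ k ∈ Finset.range n, (N k : ℝ)) * |x - y| ≤ 1 := by
  have hfloor := floor_prod_mul_eq hx hy h
  simp only [Nat.cast_prod] at hfloor
  set P := ∏ k ∈ Finset.range n, (N k : ℝ)
  have hP : 0 ≤ P := by positivity
  have hfloor' : (⌊P * x⌋₊ : ℝ) = ⌊P * y⌋₊ := congrArg _ hfloor
  rw [← abs_of_nonneg hP, ← abs_mul, mul_sub, abs_sub_le_iff]
  constructor <;> linarith [Nat.floor_le (mul_nonneg hP hx.1), Nat.lt_floor_add_one (P * x),
    Nat.floor_le (mul_nonneg hP hy.1), Nat.lt_floor_add_one (P * y)]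

lemma injOn_radixDigit (hN : ∀ k, 2 ≤ N k) : Set.InjOn (radixDigit N) (Set.Ico 0 1) := by
  intro x hx y hy h
  have hsmall (n : ℕ) : |x - y| ≤ (1 / 2) ^ n := by
    have hpow : (2 : ℝ) ^ n ≤ ∏ k ∈ Finset.range n, (N k : ℝ) := by
      simpa using Finset.prod_le_prod (s := Finset.range n) (f := fun _ => (2 : ℝ))
        (fun _ _ => zero_le_two) fun k _ => by exact_mod_cast hN k
    rw [one_div_pow, le_div_iff₀' (by positivity)]
    exact (mul_le_mul_of_nonneg_right hpow (abs_nonneg _)).trans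
      (prod_mul_abs_sub_le_one hx hy fun k _ => congrFun h k)
  refine eq_of_abs_sub_nonpos (ge_of_tendsto' (x := atTop) ?_ hsmall)
  exact tendsto_pow_atTop_nhds_zero_of_lt_one (by norm_num) (by norm_num)

lemma abs_sub_le_mul_dist_rpow {X : Type*} [MetricSpace X] {φ : (∀ k, Fin (N k)) → X}
    {C r : ℝ≥0} (hN : ∀ k, 2 ≤ N k)
    (hφ : ∀ d e n, (∀ k < n, d k = e k) → d n ≠ e n →
      1 ≤ C * (∏ k ∈ Finset.range n, (N k : ℝ)) * dist (φ d) (φ e) ^ (r : ℝ))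
    (hx : x ∈ Set.Ico (0 : ℝ) 1) (hy : y ∈ Set.Ico (0 : ℝ) 1) :
    |x - y| ≤ C * dist (φ (radixDigit N x)) (φ (radixDigit N y)) ^ (r : ℝ) := by
  rcases eq_or_ne x y with rfl | hxy
  · rw [sub_self, abs_zero]
    positivity
  have hne := (injOn_radixDigit hN).ne hx hy hxy
  have heq : ∀ k < PiNat.firstDiff (radixDigit N x) (radixDigit N y),
      radixDigit N x k = radixDigit N y k := fun k => PiNat.apply_eq_of_lt_firstDiff
  have hsep := hφ _ _ _ heq (PiNat.apply_firstDiff_ne hne)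
  have hclose := prod_mul_abs_sub_le_one hx hy heq
  set P := ∏ k ∈ Finset.range (PiNat.firstDiff (radixDigit N x) (radixDigit N y)), (N k : ℝ)
  set ε := dist (φ (radixDigit N x)) (φ (radixDigit N y)) ^ (r : ℝ)
  calc |x - y| ≤ |x - y| * (C * P * ε) := le_mul_of_one_le_right (abs_nonneg _) hsep
    _ = P * |x - y| * (C * ε) := by ring
    _ ≤ C * ε := mul_le_of_le_one_left (by positivity) hclose

lemma le_dimH_range_of_separated {X : Type*} [MetricSpace X] {φ : (∀ k, Fin (N k)) → X}
    {C r : ℝ≥0} (hr : 0 < r) (hN : ∀ k, 2 ≤ N k)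
    (hφ : ∀ d e n, (∀ k < n, d k = e k) → d n ≠ e n →
      1 ≤ C * (∏ k ∈ Finset.range n, (N k : ℝ)) * dist (φ d) (φ e) ^ (r : ℝ)) :
    r ≤ dimH (Set.range φ) := by
  have hholder := dimH_le_dimH_image_div (f := φ ∘ radixDigit N) (C := C) hr
    fun x (hx : x ∈ Set.Ico (0 : ℝ) 1) y hy => by
      rw [edist_dist, edist_dist, ENNReal.ofReal_rpow_of_nonneg dist_nonneg r.coe_nonneg,
        ← ENNReal.ofReal_coe_nnreal, ← ENNReal.ofReal_mul C.coe_nonneg]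
      exact ENNReal.ofReal_le_ofReal (abs_sub_le_mul_dist_rpow hN hφ hx hy)
  rw [Real.dimH_of_nonempty_interior (by simp), Module.finrank_self, Nat.cast_one,
    ENNReal.le_div_iff_mul_le (.inl (by exact_mod_cast hr.ne')) (.inl ENNReal.coe_ne_top),
    one_mul] at hholder
  exact hholder.trans (dimH_mono (Set.image_subset_range _ _ |>.trans
    (Set.range_comp_subset_range _ _)))

end MixedRadix

section Scales

variable {ℓ : ℕ → ℝ}

lemma tendsto_sum_range_atTop (hℓ0 : ∀ k, 0 ≤ ℓ k) (hℓ : Tendsto ℓ atTop atTop) :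
    Tendsto (fun n => ∑ k ∈ Finset.range n, ℓ k) atTop atTop :=
  (not_summable_iff_tendsto_nat_atTop_of_nonneg hℓ0).1 fun h =>
    not_tendsto_nhds_of_tendsto_atTop hℓ 0 h.tendsto_atTop_zero

lemma isLittleO_const_sum_range (hℓ0 : ∀ k, 0 ≤ ℓ k) (hℓ : Tendsto ℓ atTop atTop) (c : ℝ) :
    (fun _ => c) =o[atTop] fun n => ∑ k ∈ Finset.range n, ℓ k :=
  Asymptotics.isLittleO_const_left.2
    (.inr (tendsto_norm_atTop_atTop.comp (tendsto_sum_range_atTop hℓ0 hℓ)))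

lemma isLittleO_natCast_sum_range (hℓ0 : ∀ k, 0 ≤ ℓ k) (hℓ : Tendsto ℓ atTop atTop) :
    (fun n : ℕ => (n : ℝ)) =o[atTop] fun n => ∑ k ∈ Finset.range n, ℓ k := by
  simpa using (Asymptotics.isLittleO_const_left.2
    (.inr (tendsto_norm_atTop_atTop.comp hℓ))).sum_range (f := fun _ => (1 : ℝ)) hℓ0
    (tendsto_sum_range_atTop hℓ0 hℓ)

lemma exists_forall_mul_sum_range_succ_le {α β r : ℝ} (hℓ0 : ∀ k, 0 ≤ ℓ k)
    (hℓ : Tendsto ℓ atTop atTop) (hℓ_sum : ℓ =o[atTop] fun n => ∑ k ∈ Finset.range n, ℓ k)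
    (hr1 : r < 1) :
    ∃ C, ∀ n, r * ∑ k ∈ Finset.range (n + 1), (α + 2 * ℓ k) ≤
      C + ∑ k ∈ Finset.range n, (β + 2 * ℓ k) := by
  have herror : (fun n : ℕ => (r * α - β) * n + r * α + 2 * r * ℓ n) =o[atTop]
      fun n => ∑ k ∈ Finset.range n, ℓ k :=
    (((isLittleO_natCast_sum_range hℓ0 hℓ).const_mul_left _).add
      (isLittleO_const_sum_range hℓ0 hℓ _)).add (hℓ_sum.const_mul_left _)
  have hdiff : ∀ᶠ n in atTop, r * ∑ k ∈ Finset.range (n + 1), (α + 2 * ℓ k) -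
      ∑ k ∈ Finset.range n, (β + 2 * ℓ k) ≤ 0 := by
    filter_upwards [herror.bound (by linarith : 0 < 2 * (1 - r))] with n hn
    rw [Real.norm_of_nonneg (Finset.sum_nonneg fun k _ => hℓ0 k)] at hn
    rw [Finset.sum_range_succ]
    simp only [Finset.sum_add_distrib, ← Finset.mul_sum, Finset.sum_const, Finset.card_range,
      nsmul_eq_mul]
    linarith [(le_abs_self _).trans hn]
  obtain ⟨C, hC⟩ := (isBoundedUnder_of_eventually_le hdiff).bddAbove_range
  exact ⟨C, fun n => sub_le_iff_le_add.1 (hC ⟨n, rfl⟩)⟩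

lemma exists_forall_prod_range_succ_rpow_le {F : ℕ → ℝ} {A c r : ℝ} (hF1 : ∀ k, 1 ≤ F k)
    (hF_top : Tendsto F atTop atTop)
    (hF_log : (fun n => Real.log (F n)) =o[atTop] fun n => ∑ k ∈ Finset.range n, Real.log (F k))
    (hA : 0 < A) (hc : 0 < c) (hr1 : r < 1) :
    ∃ C > 0, ∀ n, (∏ k ∈ Finset.range (n + 1), (A * F k) ^ 2) ^ r ≤
      C * ∏ k ∈ Finset.range n, c * F k ^ 2 := by
  have hF (k : ℕ) : 0 < F k := one_pos.trans_le (hF1 k)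
  obtain ⟨C, hC⟩ := exists_forall_mul_sum_range_succ_le (α := 2 * Real.log A) (β := Real.log c)
    (fun k => Real.log_nonneg (hF1 k)) (Real.tendsto_log_atTop.comp hF_top) hF_log hr1
  refine ⟨Real.exp C, Real.exp_pos C, fun n => ?_⟩
  have hlhs (k : ℕ) : Real.log ((A * F k) ^ 2) = 2 * Real.log A + 2 * Real.log (F k) := by
    rw [Real.log_pow, Real.log_mul hA.ne' (hF k).ne']
    push_cast
    ring
  have hrhs (k : ℕ) : Real.log (c * F k ^ 2) = Real.log c + 2 * Real.log (F k) := by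
    rw [Real.log_mul hc.ne' (pow_pos (hF k) 2).ne', Real.log_pow, Nat.cast_ofNat]
  have hPpos (k : ℕ) : 0 < c * F k ^ 2 := mul_pos hc (pow_pos (hF k) 2)
  have hQpos (k : ℕ) : 0 < (A * F k) ^ 2 := pow_pos (mul_pos hA (hF k)) 2
  have hP := Finset.prod_pos fun k (_ : k ∈ Finset.range n) => hPpos k
  have hQ := Finset.prod_pos fun k (_ : k ∈ Finset.range (n + 1)) => hQpos k
  rw [← Real.log_le_log_iff (Real.rpow_pos_of_pos hQ r) (mul_pos (Real.exp_pos C) hP),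
    Real.log_rpow hQ, Real.log_mul (Real.exp_ne_zero C) hP.ne', Real.log_exp,
    Real.log_prod fun k _ => (hQpos k).ne', Real.log_prod fun k _ => (hPpos k).ne']
  simpa only [hlhs, hrhs] using hC n

end Scales

section DigitBox

/-- The Gaussian integers `i + j I` with `m ≤ i ≤ M` and `0 ≤ j ≤ m`, so that `maxNorm` is the real
part: a supply of digits with prescribed bounds on `maxNorm`. -/
noncomputable def digitBox (m M : ℤ) : Finset GaussianInt :=
  (Finset.Icc ![m, 0] ![M, m]).map gaussianVec.symm.toEmbedding

variable {a : GaussianInt} {m M : ℤ}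

lemma mem_digitBox : a ∈ digitBox m M ↔ (m ≤ a.re ∧ a.re ≤ M) ∧ 0 ≤ a.im ∧ a.im ≤ m := by
  simp [digitBox, Finset.mem_map_equiv, Finset.mem_Icc, Pi.le_def, Fin.forall_fin_two,
    and_and_and_comm]

lemma card_digitBox (hm : 0 ≤ m) (hmM : m ≤ M) :
    ((digitBox m M).card : ℤ) = (M + 1 - m) * (m + 1) := by
  have hre : m ≤ M + 1 := by omega
  have him : 0 ≤ m + 1 := by omega
  simp [digitBox, Pi.card_Icc, hre, him]

lemma maxNorm_of_mem_digitBox (ha : a ∈ digitBox m M) : maxNorm a = a.re := by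
  obtain ⟨⟨hm, -⟩, him, him'⟩ := mem_digitBox.1 ha
  rw [maxNorm, GaussianInt.re_toComplex, GaussianInt.im_toComplex, ← Int.cast_abs, ← Int.cast_abs,
    abs_of_nonneg him, abs_of_nonneg (by omega)]
  exact max_eq_left (by exact_mod_cast him'.trans hm)

lemma norm_le_of_mem_digitBox (ha : a ∈ digitBox m M) : ‖(a : ℂ)‖ ≤ M + m := by
  obtain ⟨⟨hm, hM⟩, him, him'⟩ := mem_digitBox.1 ha
  refine (Complex.norm_le_abs_re_add_abs_im _).trans ?_
  rw [GaussianInt.re_toComplex, GaussianInt.im_toComplex, ← Int.cast_abs, ← Int.cast_abs,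
    abs_of_nonneg him, abs_of_nonneg (by omega)]
  exact_mod_cast add_le_add hM him'

lemma exists_finset_maxNorm_mem_Icc {φ γ L : ℝ} (hφ : 1 ≤ φ) (hL : 1 < L) (hγ : L * φ ≤ γ)
    (hint : ∃ p : ℤ, φ ≤ p ∧ p ≤ γ) :
    ∃ S : Finset GaussianInt, 2 ≤ S.card ∧ (L - 1) / 2 * φ ^ 2 ≤ S.card ∧
      ∀ a ∈ S, φ ≤ maxNorm a ∧ maxNorm a ≤ γ ∧ ‖(a : ℂ)‖ ≤ (L + 3) * φ := by
  obtain ⟨p, hp, hpγ⟩ := hint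
  obtain ⟨m, M, hφm, hmφ, hmM, hMφ, hLM, hMγ⟩ : ∃ m M : ℤ, φ ≤ m ∧ m < φ + 1 ∧ m ≤ M ∧
      M ≤ L * φ + 1 ∧ L * φ < M + 1 ∧ M ≤ γ := by
    have hm : (⌈φ⌉ : ℝ) ≤ p := by exact_mod_cast Int.ceil_le.2 hp
    refine ⟨⌈φ⌉, max ⌈φ⌉ ⌊L * φ⌋, Int.le_ceil φ, Int.ceil_lt_add_one φ, le_max_left _ _, ?_, ?_, ?_⟩
    all_goals push_cast
    · exact max_le (by nlinarith [Int.ceil_lt_add_one φ]) (by linarith [Int.floor_le (L * φ)])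
    · linarith [Int.lt_floor_add_one (L * φ), le_max_right (⌈φ⌉ : ℝ) ⌊L * φ⌋]
    · exact max_le (hm.trans hpγ) ((Int.floor_le _).trans hγ)
  have hm : 1 ≤ m := by exact_mod_cast hφ.trans hφm
  have hcard := card_digitBox (by omega : 0 ≤ m) hmM
  refine ⟨digitBox m M, ?_, ?_, fun a ha => ?_⟩
  · zify
    nlinarith
  · have hwidth : (L - 1) / 2 * φ ≤ M + 1 - m := by
      have h : (1 : ℝ) ≤ M + 1 - m := by exact_mod_cast (by omega : 1 ≤ M + 1 - m)
      linarith
    calc (L - 1) / 2 * φ ^ 2 = (L - 1) / 2 * φ * φ := by ring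
      _ ≤ (M + 1 - m) * (m + 1) := by gcongr <;> nlinarith
      _ = (digitBox m M).card := by exact_mod_cast hcard.symm
  obtain ⟨⟨ham, haM⟩, -⟩ := mem_digitBox.1 ha
  rw [maxNorm_of_mem_digitBox ha]
  refine ⟨hφm.trans (by exact_mod_cast ham), le_trans (by exact_mod_cast haM) hMγ, ?_⟩
  exact (norm_le_of_mem_digitBox ha).trans (by linarith)

end DigitBox

section UpperBound

open scoped NNReal

lemma tendsto_sum_of_eventually_notMem {ι α G : Type*} [AddCommGroup G] [TopologicalSpace G]
    [IsTopologicalAddGroup G] {p : α → G} (hp : Summable p) {l : Filter ι} {D : ι → Finset α}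
    (hD : ∀ a, ∀ᶠ k in l, a ∉ D k) : Tendsto (fun k => ∑ a ∈ D k, p a) l (𝓝 0) := by
  refine tendsto_def.2 fun U hU => ?_
  obtain ⟨S, hS⟩ := hp.vanishing hU
  filter_upwards [(eventually_all_finset S).2 fun a _ => hD a] with k hk
  exact hS _ (Finset.disjoint_right.2 hk)

lemma eventually_sum_rpow_le_one {D : ℕ → Finset GaussianInt}
    (hD : ∀ a, ∀ᶠ k in atTop, a ∉ D k) {s : ℝ} (hs : 1 < s) :
    ∀ᶠ k in atTop, ∑ a ∈ D k, (((3 / 4 * ‖(a : ℂ)‖₊)⁻¹) ^ 2) ^ s ≤ 1 := by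
  have hsummable : Summable fun a : GaussianInt => (((3 / 4 * ‖(a : ℂ)‖)⁻¹) ^ 2) ^ s := by
    refine ((summable_norm_rpow_neg (t := 2 * s) (by linarith)).mul_left
      ((3 / 4 : ℝ) ^ (-(2 * s)))).congr fun a => ?_
    rw [← Real.mul_rpow (by norm_num) (norm_nonneg _), Real.rpow_neg (by positivity),
      Real.rpow_mul (by positivity), inv_pow, Real.inv_rpow (by positivity), Real.rpow_two]
  filter_upwards [(tendsto_sum_of_eventually_notMem hsummable hD).eventually_le_const one_pos]
    with k hk
  rw [← NNReal.coe_le_coe]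
  push_cast
  exact hk

lemma dimH_hurwitzBand_le_one {f g : ℕ → ℝ} (hf : ∀ n, 1 ≤ n → 2 < f n)
    (hf_top : Tendsto f atTop atTop) : dimH (hurwitzBand f g) ≤ 1 := by
  have hfin (k : ℕ) : {a : GaussianInt | f (k + 1) ≤ maxNorm a ∧ maxNorm a ≤ g (k + 1)}.Finite :=
    (finite_setOf_maxNorm_le _).subset fun a ha => ha.2
  have hthree (k : ℕ) (a : GaussianInt) (ha : f (k + 1) ≤ maxNorm a) : 3 ≤ ‖(a : ℂ)‖ :=
    (three_le_maxNorm ((hf (k + 1) k.succ_pos).trans_le ha)).trans (maxNorm_le_norm _)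
  have hmem : ∀ z ∈ hurwitzBand f g, ∀ k, f (k + 1) ≤ maxNorm (hurwitzElement z (k + 1)) ∧
      maxNorm (hurwitzElement z (k + 1)) ≤ g (k + 1) := fun z hz k => hz.2.2 (k + 1) k.succ_pos
  have hescape (a : GaussianInt) : ∀ᶠ k in atTop, a ∉ (hfin k).toFinset := by
    filter_upwards [(hf_top.comp (tendsto_add_atTop_nat 1)).eventually_gt_atTop (maxNorm a)]
      with k hk ha
    exact hk.not_ge ((hfin k).mem_toFinset.1 ha).1
  refine ENNReal.le_of_forall_pos_le_add fun ε hε _ => ?_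
  rw [← ENNReal.coe_one, ← ENNReal.coe_add]
  refine dimH_le_of_digitCylinders (digit := fun z k => hurwitzElement z (k + 1))
    (D := fun k => (hfin k).toFinset) (p := fun a => (3 / 4 * ‖(a : ℂ)‖₊)⁻¹ ^ 2) (K := 3 / 2)
    (ρ := 1 / 2) (by norm_num) (fun z hz k => (hfin k).mem_toFinset.2 (hmem z hz k)) ?_ ?_
    (eventually_sum_rpow_le_one hescape (by exact_mod_cast lt_add_of_pos_right 1 hε))
  · intro k a ha
    have h := hthree k a ((hfin k).mem_toFinset.1 ha).1
    calc (3 / 4 * ‖(a : ℂ)‖₊)⁻¹ ^ 2 ≤ (3 / 4 * 3)⁻¹ ^ 2 := by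
          gcongr
          exact_mod_cast h
      _ ≤ 1 / 2 := by
          rw [← NNReal.coe_le_coe]
          norm_num
  · intro z hz y hy n hzy
    rw [edist_le_coe, ← NNReal.coe_le_coe, coe_nndist, dist_eq_norm]
    have h := hz.2.1.isHurwitzExpansion.norm_sub_le hy.2.1.isHurwitzExpansion hzy
      fun k _ => hthree k _ (hmem z hz k).1
    rw [hurwitzRemainder_zero hz.1, hurwitzRemainder_zero hy.1] at h
    push_cast
    exact h

end UpperBound

section LowerBound

open scoped NNReal

lemma le_dimH_hurwitzBand {f g R : ℕ → ℝ} {S : ℕ → Finset GaussianInt} {C r : ℝ≥0}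
    (hS : ∀ k, 2 ≤ (S k).card)
    (hband : ∀ k, ∀ a ∈ S k, f (k + 1) ≤ maxNorm a ∧ maxNorm a ≤ g (k + 1))
    (hthree : ∀ k, ∀ a ∈ S k, 3 ≤ ‖(a : ℂ)‖) (hR : ∀ k, ∀ a ∈ S k, ‖(a : ℂ)‖ ≤ R k) (hr : 0 < r)
    (hC : ∀ n, (∏ k ∈ Finset.range (n + 1), (5 / 4 * R k) ^ 2) ^ (r : ℝ) ≤
      C * ∏ k ∈ Finset.range n, ((S k).card : ℝ)) :
    r ≤ dimH (hurwitzBand f g) := by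
  have (k : ℕ) : NeZero (S k).card := ⟨by linarith [hS k]⟩
  let digits (d : ∀ k, Fin (S k).card) (k : ℕ) : GaussianInt := (S k).equivFin.symm (d k)
  have hdigits (d) (k : ℕ) : digits d k ∈ S k := ((S k).equivFin.symm (d k)).2
  choose w hw using fun d => exists_isHurwitzExpansion fun k => hthree k _ (hdigits d k)
  have hrange : Set.range (fun d => w d 0) ⊆ hurwitzBand f g :=
    Set.range_subset_iff.2 fun d => (hw d).mem_hurwitzBand fun k => hband k _ (hdigits d k)
  refine le_trans ?_ (dimH_mono hrange)
  refine le_dimH_range_of_separated (C := 9 ^ (r : ℝ) * C) hr hS fun d e n hlt hne => ?_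
  have hsep := (hw d).inv_prod_sq_le_norm_sub (hw e) (n := n)
    (fun k hk => by simp only [digits, hlt k hk])
    (fun h => hne ((S n).equivFin.symm.injective (Subtype.ext h)))
    (fun k => hthree k _ (hdigits d k)) (fun k => hthree k _ (hdigits e k))
    (fun k => hR k _ (hdigits d k)) (fun k => hR k _ (hdigits e k))
  have hC := hC n
  rw [← dist_eq_norm] at hsep
  set Q := ∏ k ∈ Finset.range (n + 1), (5 / 4 * R k) ^ 2
  set ε := dist (w d 0) (w e 0)
  have hQ : 0 < Q := Finset.prod_pos fun k _ => by
    have : 0 < R k := by linarith [hthree k _ (hdigits d k), hR k _ (hdigits d k)]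
    positivity
  calc 1 ≤ (9 * Q * ε) ^ (r : ℝ) :=
        Real.one_le_rpow ((inv_le_iff_one_le_mul₀' (by positivity)).1 hsep) r.coe_nonneg
    _ = 9 ^ (r : ℝ) * Q ^ (r : ℝ) * ε ^ (r : ℝ) := by
        rw [Real.mul_rpow (by positivity) dist_nonneg, Real.mul_rpow (by norm_num) hQ.le]
    _ ≤ 9 ^ (r : ℝ) * (C * ∏ k ∈ Finset.range n, ((S k).card : ℝ)) * ε ^ (r : ℝ) := by gcongr
    _ = _ := by push_cast; ring

lemma one_le_dimH_hurwitzBand {f g : ℕ → ℝ} {L : ℝ} (hL : 1 < L) (hf : ∀ n, 1 ≤ n → 2 < f n)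
    (hfg : ∀ n, 1 ≤ n → L * f n ≤ g n) (hint : ∀ n, 1 ≤ n → ∃ m : ℤ, f n ≤ m ∧ m ≤ g n)
    (hf_top : Tendsto f atTop atTop)
    (hf_log : (fun n => Real.log (f (n + 1))) =o[atTop]
      fun n => ∑ k ∈ Finset.range n, Real.log (f (k + 1))) :
    1 ≤ dimH (hurwitzBand f g) := by
  have hf' (k : ℕ) : 2 < f (k + 1) := hf (k + 1) k.succ_pos
  choose S hS hcard hSmem using fun k : ℕ => exists_finset_maxNorm_mem_Icc
    (one_le_two.trans (hf' k).le) hL (hfg (k + 1) k.succ_pos) (hint (k + 1) k.succ_pos)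
  have hthree : ∀ k, ∀ a ∈ S k, 3 ≤ ‖(a : ℂ)‖ := fun k a ha =>
    (three_le_maxNorm ((hf' k).trans_le (hSmem k a ha).1)).trans (maxNorm_le_norm _)
  refine ENNReal.le_of_forall_nnreal_lt fun r hr => ?_
  rcases eq_zero_or_pos r with rfl | hr0
  · simp
  obtain ⟨C, hC0, hC⟩ := exists_forall_prod_range_succ_rpow_le (F := fun k => f (k + 1))
    (A := 5 / 4 * (L + 3)) (c := (L - 1) / 2) (fun k => one_le_two.trans (hf' k).le)
    (hf_top.comp (tendsto_add_atTop_nat 1)) hf_log (by linarith) (by linarith)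
    (by exact_mod_cast hr)
  lift C to ℝ≥0 using hC0.le
  refine le_dimH_hurwitzBand (C := C) hS (fun k a ha => ⟨(hSmem k a ha).1, (hSmem k a ha).2.1⟩)
    hthree (fun k a ha => (hSmem k a ha).2.2) hr0 fun n => ?_
  simp only [← mul_assoc]
  refine (hC n).trans ?_
  gcongr
  exact hcard _

end LowerBound

section Growth

lemma isBigO_log_of_limsup_lt_one {g : ℕ → ℝ} (hg1 : ∀ᶠ n in atTop, 1 < g n)
    (hg : limsup (fun n : ℕ => ((Real.log (Real.log (g n)) / Real.log n : ℝ) : EReal)) atTop < 1) :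
    (fun n => Real.log (g n)) =O[atTop] fun n => (n : ℝ) := by
  refine Asymptotics.IsBigO.of_bound' ?_
  filter_upwards [hg1, eventually_lt_of_limsup_lt hg, eventually_gt_atTop 1] with n hgn hn hn1
  have hn1' : (1 : ℝ) < n := by exact_mod_cast hn1
  have hlog := Real.log_pos hgn
  have hratio : Real.log (Real.log (g n)) / Real.log n < 1 := by exact_mod_cast hn
  rw [div_lt_one (Real.log_pos hn1'), Real.log_lt_log_iff hlog (by linarith)] at hratio
  rw [Real.norm_of_nonneg hlog.le, RCLike.norm_natCast]
  exact hratio.le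

lemma isLittleO_log_sum_range {f g : ℕ → ℝ} (hf : ∀ n, 1 ≤ n → 1 < f n)
    (hfg : ∀ n, 1 ≤ n → f n ≤ g n) (hf_top : Tendsto f atTop atTop)
    (hg : limsup (fun n : ℕ => ((Real.log (Real.log (g n)) / Real.log n : ℝ) : EReal)) atTop < 1) :
    (fun n => Real.log (f (n + 1))) =o[atTop]
      fun n => ∑ k ∈ Finset.range n, Real.log (f (k + 1)) := by
  have hlog0 (k : ℕ) : 0 < Real.log (f (k + 1)) := Real.log_pos (hf _ k.succ_pos)
  have hlog_top : Tendsto (fun k => Real.log (f (k + 1))) atTop atTop :=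
    Real.tendsto_log_atTop.comp (hf_top.comp (tendsto_add_atTop_nat 1))
  have hg1 : ∀ᶠ n in atTop, 1 < g n := by
    filter_upwards [eventually_ge_atTop 1] with n hn using (hf n hn).trans_le (hfg n hn)
  have hlinear : (fun n => Real.log (f (n + 1))) =O[atTop] fun n : ℕ => (n + 1 : ℝ) := by
    refine .trans (.of_norm_le fun n => ?_)
      (by simpa [Function.comp_def] using
        (isBigO_log_of_limsup_lt_one hg1 hg).comp_tendsto (tendsto_add_atTop_nat 1))
    rw [Real.norm_of_nonneg (hlog0 n).le]
    exact Real.log_le_log (one_pos.trans (hf _ n.succ_pos)) (hfg _ n.succ_pos)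
  exact hlinear.trans_isLittleO ((isLittleO_natCast_sum_range (fun k => (hlog0 k).le) hlog_top).add
    (isLittleO_const_sum_range (fun k => (hlog0 k).le) hlog_top 1))

end Growth

theorem lemma4p2_general (f g : ℕ → ℝ) (L : ℝ) (hL : 1 < L)
    (hf : ∀ n, 1 ≤ n → 2 < f n)
    (hfg : ∀ n, 1 ≤ n → L * f n ≤ g n)
    (hint : ∀ n, 1 ≤ n → ∃ m : ℤ, f n ≤ m ∧ m ≤ g n)
    (hf_top : Tendsto f atTop atTop)
    (hf_log : (fun n => Real.log (f (n + 1))) =o[atTop]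
      fun n => ∑ k ∈ Finset.range n, Real.log (f (k + 1))) :
    dimH (hurwitzBand f g) = 1 :=
  le_antisymm (dimH_hurwitzBand_le_one hf hf_top)
    (one_le_dimH_hurwitzBand hL hf hfg hint hf_top hf_log)

theorem lemma4p2 (f g : ℕ → ℝ) (c' : ℝ) (hc'0 : 0 < c') (hc'1 : c' < 1)
    (hf : ∀ n : ℕ, 1 ≤ n → Real.sqrt 8 ≤ f n)
    (hfg : ∀ n : ℕ, 1 ≤ n → f n < c' * g n)
    (hint : ∀ n : ℕ, 1 ≤ n → ∃ m : ℤ, f n ≤ (m : ℝ) ∧ (m : ℝ) ≤ g n)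
    (hf_top : Tendsto f atTop atTop)
    (hg : limsup (fun n : ℕ => ((Real.log (Real.log (g n)) / Real.log (n : ℝ) : ℝ) : EReal))
      atTop < 1) :
    dimH (hurwitzBand f g) = 1 := by
  have hf2 (n : ℕ) (hn : 1 ≤ n) : 2 < f n :=
    ((Real.lt_sqrt zero_le_two).2 (by norm_num)).trans_le (hf n hn)
  have hfg' (n : ℕ) (hn : 1 ≤ n) : c'⁻¹ * f n ≤ g n := (inv_mul_le_iff₀ hc'0).2 (hfg n hn).le
  have hfle (n : ℕ) (hn : 1 ≤ n) : f n ≤ g n :=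
    (le_mul_of_one_le_left (two_pos.trans (hf2 n hn)).le ((one_le_inv₀ hc'0).2 hc'1.le)).trans
      (hfg' n hn)
  exact lemma4p2_general f g c'⁻¹ ((one_lt_inv₀ hc'0).2 hc'1) hf2 hfg' hint hf_top
    (isLittleO_log_sum_range (fun n hn => one_lt_two.trans (hf2 n hn)) hfle hf_top hg)
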